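/- Let $R$ be a commutative ring with identity. A finitely generated ideal $J$ of $R$ is a GV-ideal if the natural homomorphism $R\to\mathrm{Hom}_R(J,R)$, $r\mapsto (j\mapsto rj)$, is an isomorphism. An $R$-module $M$ is GV-torsion-free if $x\in M$ and $Jx=0$ for some GV-ideal $J$ imply $x=0$; a GV-torsion-free module $M$ is a $w$-module if $\mathrm{Ext}^1_R(R/J,M)=0$ for every GV-ideal $J$ of $R$. A $w$-ideal is an ideal of $R$ that is a $w$-module, and a maximal $w$-ideal is an ideal maximal among the proper $w$-ideals. The $w$-Krull dimension $w\text{-}\dim(R)$ is the supremum of the heights of all maximal $w$-ideals of $R$ (the supremum of the empty set being $-\infty$), and $R$ is a DW ring if every ideal of $R$ is a $w$-ideal. **Theorem.** Let $R$ be a commutative ring with identity such that $w\text{-}\dim(R)=0$. Then the Krull dimension of $R$ is $0$, and $R$ is a DW ring. -/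

import Mathlib

universe u

section WOperation

variable {R : Type u} [CommRing R]

/-- A GV-ideal (Glaz--Vasconcelos ideal): a finitely generated ideal `J` of `R` such that the
natural homomorphism `R → Hom_R(J, R)`, `r ↦ (j ↦ r * j)`, is an isomorphism. -/
def IsGVIdeal (J : Ideal R) : Prop :=
  J.FG ∧ Function.Bijective (fun r : R => (r • J.subtype : J →ₗ[R] R))

/-- A module `M` is GV-torsion-free if no nonzero element of `M` is killed by a GV-ideal. -/
def IsGVTorsionFree (R : Type u) [CommRing R] (M : Type u) [AddCommGroup M] [Module R M] : Prop :=
  ∀ J : Ideal R, IsGVIdeal J → ∀ x : M, (∀ j ∈ J, j • x = 0) → x = 0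

/-- A `w`-module: a GV-torsion-free module `M` with `Ext¹_R(R/J, M) = 0` for every GV-ideal `J`. -/
def IsWModule (R : Type u) [CommRing R] (M : Type u) [AddCommGroup M] [Module R M] : Prop :=
  IsGVTorsionFree R M ∧
    ∀ J : Ideal R, IsGVIdeal J →
      Subsingleton (CategoryTheory.Abelian.Ext (ModuleCat.of R (R ⧸ J)) (ModuleCat.of R M) 1)

/-- A `w`-ideal: an ideal that is a `w`-module. -/
def IsWIdeal (I : Ideal R) : Prop := IsWModule R I

/-- A maximal `w`-ideal: maximal among the proper `w`-ideals. -/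
def IsMaximalWIdeal (m : Ideal R) : Prop :=
  Maximal (fun I : Ideal R => IsWIdeal I ∧ I ≠ ⊤) m

/-- The `w`-Krull dimension: the supremum of the heights of the maximal `w`-ideals
(with the value `⊥` for the zero ring, as for `ringKrullDim`). -/
noncomputable def wKrullDim (R : Type u) [CommRing R] : WithBot ℕ∞ :=
  ⨆ (m : Ideal R) (_ : IsMaximalWIdeal m), (m.height : WithBot ℕ∞)

/-- A DW ring: every ideal is a `w`-ideal. -/
def IsDWRing (R : Type u) [CommRing R] : Prop := ∀ I : Ideal R, IsWIdeal I

end WOperation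

/-!
The first step is to see that an ideal `I` is a `w`-ideal if and only if `J x ⊆ I` with `J` a
GV-ideal forces `x ∈ I`. Since GV-ideals are finitely generated and closed under products, Zorn's
lemma then puts every ideal containing no GV-ideal inside a maximal `w`-ideal that is prime
(`exists_isMaximalWIdeal_of_forall_not_le`); if `w-dim R = 0`, this prime is minimal.

Fix `a : R`. The ideal of all `s` with `s aⁿ⁺¹ ∈ aⁿ⁺² R` for some `n` lies in no minimal prime `p`
that is a maximal `w`-ideal: it contains `a`, and if `a ∈ p` then `s aⁿ = 0` for some `s ∉ p`. So
it contains a GV-ideal, and a power `J` of that GV-ideal satisfies `J b ⊆ b² R` for a power `b = aⁿ`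
with `n ≥ 1`. Using the isomorphism `R ≅ Hom(J, R)` twice removes `J` and gives `b ∈ b² R`
(`IsGVIdeal.exists_eq_mul_sq`): the first use produces an idempotent `e` with `b = e b`, the second
an inverse of `b` in `e R`. Hence every element of `R` has a positive power `b` with `b ∈ b² R`, and
every prime ideal is maximal.

Finally, a GV-ideal is finitely generated with zero annihilator, as are its powers, so it lies in no
minimal prime (`IsGVIdeal.not_le_of_mem_minimalPrimes`). In dimension zero all primes are minimal,
so the only GV-ideal is `R` itself and every ideal is a `w`-ideal.
-/

/-! ### The first Ext group of a cyclic module -/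

open CategoryTheory Abelian in
/-- The low-degree exact sequence of `Hom(-, M)` for `0 → J → R → R/J → 0`: since `R` is projective,
`Ext¹(R/J, M)` is the cokernel of the restriction map `Hom(R, M) → Hom(J, M)`. -/
theorem subsingleton_ext_one_quotient_iff {R : Type u} [CommRing R] (J : Ideal R)
    (M : Type u) [AddCommGroup M] [Module R M] :
    Subsingleton (Ext (ModuleCat.of R (R ⧸ J)) (ModuleCat.of R M) 1) ↔
      ∀ f : J →ₗ[R] M, ∃ g : R →ₗ[R] M, g ∘ₗ J.subtype = f := by
  let S : ShortComplex (ModuleCat.{u} R) :=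
    ShortComplex.mk (ModuleCat.ofHom J.subtype) (ModuleCat.ofHom J.mkQ) (by
      ext x
      exact (Submodule.Quotient.mk_eq_zero J).2 x.2)
  have hS : S.ShortExact :=
    { exact := (ShortComplex.ShortExact.moduleCat_exact_iff_function_exact S).2
        (LinearMap.exact_subtype_mkQ J)
      mono_f := (ModuleCat.mono_iff_injective _).2 J.injective_subtype
      epi_g := (ModuleCat.epi_iff_surjective _).2 J.mkQ_surjective }
  constructor
  · intro _ f
    obtain ⟨x, hx⟩ := Ext.contravariant_sequence_exact₁ hS (ModuleCat.of R M)
      (Ext.mk₀ (ModuleCat.ofHom f)) (add_zero 1)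
      (Subsingleton.elim (α := Ext (ModuleCat.of R (R ⧸ J)) (ModuleCat.of R M) 1) _ _)
    obtain ⟨g, rfl⟩ := Ext.addEquiv₀.symm.surjective x
    refine ⟨g.hom, ?_⟩
    simp only [Ext.addEquiv₀_symm_apply, Ext.mk₀_comp_mk₀] at hx
    have := Ext.addEquiv₀.symm.injective hx
    exact congrArg ModuleCat.Hom.hom this
  · intro h
    refine subsingleton_of_forall_eq 0 fun x => ?_
    have : Projective S.X₂ := ModuleCat.projective_of_categoryTheory_projective (ModuleCat.of R R)
    obtain ⟨y, rfl⟩ := Ext.contravariant_sequence_exact₃ hS (ModuleCat.of R M) x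
      (Ext.eq_zero_of_projective _) (add_zero 1)
    obtain ⟨f, rfl⟩ := Ext.addEquiv₀.symm.surjective y
    obtain ⟨g, hg⟩ := h f.hom
    have hf : f = S.f ≫ ModuleCat.ofHom g := by
      ext x
      exact (LinearMap.congr_fun hg x).symm
    rw [hf, Ext.addEquiv₀_symm_apply, ← Ext.mk₀_comp_mk₀,
      ShortComplex.ShortExact.extClass_comp_assoc]

section

variable {R : Type u} [CommRing R]

/-! ### GV-ideals -/

namespace IsGVIdeal

variable {J K : Ideal R}

theorem eq_zero (hJ : IsGVIdeal J) {x : R} (h : ∀ j ∈ J, j * x = 0) : x = 0 := by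
  refine hJ.2.1 (LinearMap.ext fun j => ?_)
  simpa [mul_comm] using h j j.2

theorem eq_of_mul_eq (hJ : IsGVIdeal J) {x y : R} (h : ∀ j ∈ J, j * x = j * y) : x = y :=
  sub_eq_zero.1 (hJ.eq_zero fun j hj => by rw [mul_sub, h j hj, sub_self])

theorem exists_linearMap_eq_mul (hJ : IsGVIdeal J) (f : J →ₗ[R] R) :
    ∃ r, ∀ j : J, f j = j * r := by
  obtain ⟨r, rfl⟩ := hJ.2.2 f
  exact ⟨r, fun j => by simp [mul_comm]⟩

theorem top : IsGVIdeal (⊤ : Ideal R) := by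
  refine ⟨Ideal.fg_top R, fun x y h => ?_, fun f => ⟨f ⟨1, trivial⟩, LinearMap.ext fun j => ?_⟩⟩
  · simpa using LinearMap.congr_fun h ⟨1, trivial⟩
  · have := f.map_smul (j : R) ⟨1, trivial⟩
    simp only [smul_eq_mul] at this
    simp only [LinearMap.smul_apply, Submodule.subtype_apply, smul_eq_mul]
    rw [mul_comm, ← this]
    congr 1
    exact Subtype.ext (mul_one _)

theorem mul (hJ : IsGVIdeal J) (hK : IsGVIdeal K) : IsGVIdeal (J * K) := by
  have inj : ∀ x y : R, (∀ j ∈ J, ∀ k ∈ K, j * k * x = j * k * y) → x = y := fun x y h =>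
    hK.eq_of_mul_eq fun k hk => hJ.eq_of_mul_eq fun j hj => by
      rw [← mul_assoc, ← mul_assoc, h j hj k hk]
  refine ⟨hJ.1.mul hK.1, fun x y h => inj x y fun j hj k hk => ?_, fun f => ?_⟩
  · simpa [mul_comm] using LinearMap.congr_fun h ⟨j * k, Ideal.mul_mem_mul hj hk⟩
  -- For fixed `k`, `j ↦ f (j * k)` is multiplication by some `g k`, and `g` is linear in `k`.
  · have key : ∀ k : K, ∃ r, ∀ (j : R) (hj : j ∈ J),
        f ⟨j * k, Ideal.mul_mem_mul hj k.2⟩ = j * r := fun k => by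
      obtain ⟨r, hr⟩ := hJ.exists_linearMap_eq_mul
        { toFun := fun j => f ⟨j * k, Ideal.mul_mem_mul j.2 k.2⟩
          map_add' := fun x y => by
            rw [← map_add]
            exact congrArg f (Subtype.ext (add_mul _ _ _))
          map_smul' := fun c x => by
            rw [← map_smul]
            exact congrArg f (Subtype.ext (mul_assoc _ _ _)) }
      exact ⟨r, fun j hj => hr ⟨j, hj⟩⟩
    choose g hg using key
    obtain ⟨r, hr⟩ := hK.exists_linearMap_eq_mul
      { toFun := g
        map_add' := fun x y => hJ.eq_of_mul_eq fun j hj => by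
          rw [mul_add, ← hg _ j hj, ← hg _ j hj, ← hg _ j hj, ← map_add]
          exact congrArg f (Subtype.ext (mul_add _ _ _))
        map_smul' := fun c x => hJ.eq_of_mul_eq fun j hj => by
          rw [RingHom.id_apply, smul_eq_mul, mul_left_comm, ← hg _ j hj, ← hg _ j hj,
            ← smul_eq_mul c, ← map_smul]
          exact congrArg f (Subtype.ext (mul_left_comm _ _ _)) }
    refine ⟨r, LinearMap.ext fun ⟨x, hx⟩ => ?_⟩
    induction hx using Submodule.mul_induction_on' with
    | mem_mul_mem j hj k hk =>
      have h₁ := hg ⟨k, hk⟩ j hj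
      have h₂ : g ⟨k, hk⟩ = k * r := hr ⟨k, hk⟩
      rw [h₁, h₂]
      simp
      ring
    | add x hx y hy ihx ihy =>
      have e : (⟨x + y, add_mem hx hy⟩ : ↥(J * K)) = ⟨x, hx⟩ + ⟨y, hy⟩ := rfl
      rw [e, map_add, map_add, ihx, ihy]

theorem pow (hJ : IsGVIdeal J) (n : ℕ) : IsGVIdeal (J ^ n) := by
  induction n with
  | zero => simpa using top
  | succ n ih => rw [pow_succ]; exact ih.mul hJ

/-- If a GV-ideal `J` satisfies `J b ⊆ b² R`, then `b` is von Neumann regular. -/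
theorem exists_eq_mul_sq (hJ : IsGVIdeal J) {b : R} (h : ∀ j ∈ J, ∃ r, j * b = r * b ^ 2) :
    ∃ c, b = c * b ^ 2 := by
  have h' : ∀ j : J, ∃ r, (j : R) * b = r * b ^ 2 := fun j => h j j.2
  choose r hr using h'
  have cancel : ∀ x : R, x * b ^ 2 = 0 → x * b = 0 := fun x hx => hJ.eq_zero fun j hj => by
    linear_combination x * hr ⟨j, hj⟩ + r ⟨j, hj⟩ * hx
  -- `j ↦ r j * b` is well defined and linear, although `r` itself need not be.
  obtain ⟨e, he⟩ := hJ.exists_linearMap_eq_mul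
    { toFun := fun j => r j * b
      map_add' := fun x y => by
        have := cancel (r (x + y) - r x - r y) (by
          have := hr (x + y)
          push_cast at this
          linear_combination hr x + hr y - this)
        linear_combination this
      map_smul' := fun c x => by
        have := cancel (r (c • x) - c * r x) (by
          have := hr (c • x)
          simp only [SetLike.val_smul, smul_eq_mul] at this
          linear_combination c * hr x - this)
        simp only [RingHom.id_apply, smul_eq_mul]
        linear_combination this }
  replace he : ∀ j : J, r j * b = j * e := he
  have heb : b = e * b := hJ.eq_of_mul_eq fun j hj => by
    linear_combination hr ⟨j, hj⟩ + b * he ⟨j, hj⟩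
  have cancel' : ∀ x : R, x * b = 0 → x * e = 0 := fun x hx => hJ.eq_zero fun j hj => by
    linear_combination r ⟨j, hj⟩ * hx - x * he ⟨j, hj⟩
  -- On the ideal generated by the idempotent `e`, `b` is a nonzerodivisor, so `j ↦ r j * e` is
  -- linear; it is multiplication by the inverse of `b` on that ideal.
  obtain ⟨c, hc⟩ := hJ.exists_linearMap_eq_mul
    { toFun := fun j => r j * e
      map_add' := fun x y => by
        have := cancel' (r (x + y) - r x - r y) (by
          have := he (x + y)
          push_cast at this
          linear_combination this - he x - he y)
        linear_combination this
      map_smul' := fun c x => by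
        have := cancel' (r (c • x) - c * r x) (by
          have := he (c • x)
          simp only [SetLike.val_smul, smul_eq_mul] at this
          linear_combination this - c * he x)
        simp only [RingHom.id_apply, smul_eq_mul]
        linear_combination this }
  replace hc : ∀ j : J, r j * e = j * c := hc
  have hcb : e = c * b := hJ.eq_of_mul_eq fun j hj => by
    linear_combination b * hc ⟨j, hj⟩ - he ⟨j, hj⟩ + r ⟨j, hj⟩ * heb
  exact ⟨c, by linear_combination heb + b * hcb⟩

end IsGVIdeal

/-! ### Maximal `w`-ideals -/

theorem isWIdeal_iff {I : Ideal R} :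
    IsWIdeal I ↔ ∀ J : Ideal R, IsGVIdeal J → ∀ x : R, (∀ j ∈ J, j * x ∈ I) → x ∈ I := by
  constructor
  · intro hI J hJ x hx
    obtain ⟨g, hg⟩ := (subsingleton_ext_one_quotient_iff J I).1 (hI.2 J hJ)
      { toFun := fun j => ⟨j * x, hx j j.2⟩
        map_add' := fun _ _ => Subtype.ext (add_mul _ _ _)
        map_smul' := fun _ _ => Subtype.ext (mul_assoc _ _ _) }
    have : x = g 1 := hJ.eq_of_mul_eq fun j hj => by
      have h₁ : g j = ⟨j * x, hx j hj⟩ := LinearMap.congr_fun hg ⟨j, hj⟩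
      have h₂ : g j = j • g 1 := by rw [← map_smul, smul_eq_mul, mul_one]
      simpa using congrArg Subtype.val (h₁.symm.trans h₂)
    exact this ▸ (g 1).2
  · intro h
    refine ⟨fun J hJ x hx => Subtype.ext (hJ.eq_zero fun j hj => ?_), fun J hJ =>
      (subsingleton_ext_one_quotient_iff J I).2 fun f => ?_⟩
    · simpa using congrArg Subtype.val (hx j hj)
    · obtain ⟨r, hr⟩ := hJ.exists_linearMap_eq_mul (I.subtype ∘ₗ f)
      have hrI : r ∈ I := h J hJ r fun j hj => by
        have := hr ⟨j, hj⟩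
        exact this ▸ (f ⟨j, hj⟩).2
      refine ⟨LinearMap.toSpanSingleton R I ⟨r, hrI⟩, LinearMap.ext fun j => Subtype.ext ?_⟩
      simpa using (hr j).symm

theorem Ideal.FG.exists_le_of_le_sSup {J : Ideal R} (hJ : J.FG) {c : Set (Ideal R)}
    (hne : c.Nonempty) (hc : DirectedOn (· ≤ ·) c) (h : J ≤ sSup c) : ∃ I ∈ c, J ≤ I :=
  (CompleteLattice.isCompactElement_iff_le_of_directed_sSup_le _ J).1
    ((Submodule.fg_iff_compact J).1 hJ) c hne hc h

/-- An ideal maximal among those containing no GV-ideal is a maximal `w`-ideal, and it is prime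
because products of GV-ideals are GV-ideals. -/
theorem exists_isMaximalWIdeal_of_forall_not_le {I : Ideal R}
    (hI : ∀ J : Ideal R, IsGVIdeal J → ¬ J ≤ I) :
    ∃ m : Ideal R, IsMaximalWIdeal m ∧ m.IsPrime ∧ I ≤ m := by
  obtain ⟨m, hIm, hm⟩ := zorn_le_nonempty₀ {I : Ideal R | ∀ J, IsGVIdeal J → ¬ J ≤ I}
    (fun c hcs hc y hy => ⟨sSup c, fun J hJ hle => by
      obtain ⟨K, hK, hJK⟩ := Ideal.FG.exists_le_of_le_sSup hJ.1 ⟨y, hy⟩ hc.directedOn hle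
      exact hcs hK J hJ hJK, fun z hz => le_sSup hz⟩) I hI
  have hext : ∀ x ∉ m, ∃ J, IsGVIdeal J ∧ J ≤ m ⊔ Ideal.span {x} := fun x hx => by
    by_contra! h
    exact hx (hm.2 h le_sup_left
      (Ideal.mem_sup_right (Ideal.mem_span_singleton_self x)))
  have hcl : ∀ J : Ideal R, IsGVIdeal J → ∀ x : R, (∀ j ∈ J, j * x ∈ m) → x ∈ m := by
    intro J hJ x hx
    by_contra hxm
    obtain ⟨K, hK, hle⟩ := hext x hxm
    refine hm.1 _ (hJ.mul hK) (Ideal.mul_le.2 fun j hj k hk => ?_)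
    obtain ⟨a, ha, b, hb, rfl⟩ := Submodule.mem_sup.1 (hle hk)
    obtain ⟨c, rfl⟩ := Ideal.mem_span_singleton'.1 hb
    rw [mul_add, mul_left_comm]
    exact add_mem (m.mul_mem_left _ ha) (m.mul_mem_left _ (hx j hj))
  have hne : m ≠ ⊤ := fun h => hm.1 ⊤ .top h.ge
  refine ⟨m, ⟨⟨isWIdeal_iff.2 hcl, hne⟩, fun N hN hmN => hm.2 (fun J hJ hle => ?_) hmN⟩,
    ⟨hne, fun {x y} hxy => ?_⟩, hIm⟩
  · exact hN.2 ((Ideal.eq_top_iff_one _).2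
      (isWIdeal_iff.1 hN.1 J hJ 1 fun j hj => by simpa using hle hj))
  · by_contra! h
    obtain ⟨J, hJ, hJle⟩ := hext x h.1
    refine h.2 (hcl J hJ y fun j hj => ?_)
    obtain ⟨a, ha, b, hb, rfl⟩ := Submodule.mem_sup.1 (hJle hj)
    obtain ⟨c, rfl⟩ := Ideal.mem_span_singleton'.1 hb
    rw [add_mul, mul_assoc]
    exact add_mem (m.mul_mem_right _ ha) (m.mul_mem_left _ hxy)

/-! ### Rings of `w`-dimension zero -/

theorem exists_notMem_mul_pow_eq_zero {p : Ideal R} (hp : p ∈ minimalPrimes R) {a : R}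
    (ha : a ∈ p) : ∃ s ∉ p, ∃ n : ℕ, s * a ^ n = 0 := by
  have hpp := hp.1.1
  by_contra! h
  -- Otherwise `0` is not in the monoid generated by `a` and the complement of `p`, and a prime
  -- avoiding this monoid is strictly smaller than `p`.
  have hdisj : Disjoint ((⊥ : Ideal R) : Set R) ↑(p.primeCompl ⊔ Submonoid.powers a) := by
    refine Set.disjoint_left.2 fun x hx hxS => ?_
    obtain ⟨s, hs, _, ⟨n, rfl⟩, rfl⟩ := Submonoid.mem_sup.1 hxS
    exact h s hs n hx
  obtain ⟨q, hq, -, hqS⟩ := Ideal.exists_le_prime_disjoint _ _ hdisj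
  have hqp : q ≤ p := fun x hx => by
    by_contra hxp
    exact Set.disjoint_left.1 hqS hx (Submonoid.mem_sup_left hxp)
  exact Set.disjoint_left.1 hqS (hp.2 ⟨hq, bot_le⟩ hqp ha)
    (Submonoid.mem_sup_right (Submonoid.mem_powers a))

/-- The ideals `(aⁿ⁺² : aⁿ⁺¹)` increase with `n`. If `w-dim R = 0`, their union lies in no maximal
`w`-ideal, so one of them contains a GV-ideal. -/
theorem exists_isGVIdeal_mul_span_pow_le (hR : wKrullDim R = 0) (a : R) :
    ∃ J : Ideal R, IsGVIdeal J ∧ ∃ n : ℕ,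
      J * Ideal.span {a} ^ (n + 1) ≤ Ideal.span {a} ^ (n + 2) := by
  let K : ℕ → Ideal R := fun n =>
    Submodule.comap (LinearMap.mulRight R (a ^ (n + 1))) (Ideal.span {a ^ (n + 2)})
  have mem_K : ∀ n s, s ∈ K n ↔ a ^ (n + 2) ∣ s * a ^ (n + 1) := fun n s => by
    simp [K, Ideal.mem_span_singleton]
  have hK : Monotone K := monotone_nat_of_le_succ fun n s hs => by
    rw [mem_K] at hs ⊢
    have := mul_dvd_mul_right hs a
    rwa [mul_assoc, ← pow_succ, ← pow_succ] at this
  by_cases h : ∃ J, IsGVIdeal J ∧ J ≤ sSup (Set.range K)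
  · obtain ⟨J, hJ, hle⟩ := h
    obtain ⟨_, ⟨n, rfl⟩, hn⟩ := Ideal.FG.exists_le_of_le_sSup hJ.1 (Set.range_nonempty K)
      hK.directed_le.directedOn_range hle
    refine ⟨J, hJ, n, ?_⟩
    rw [Ideal.span_singleton_pow, Ideal.span_singleton_pow, Ideal.mul_le]
    intro j hj x hx
    obtain ⟨c, rfl⟩ := Ideal.mem_span_singleton'.1 hx
    rw [mul_left_comm]
    exact Ideal.mul_mem_left _ _ (hn hj)
  · push Not at h
    obtain ⟨m, hm, hmp, hle⟩ := exists_isMaximalWIdeal_of_forall_not_le h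
    have hle' : ∀ n, K n ≤ m := fun n => (le_sSup (Set.mem_range_self n)).trans hle
    have h0 : m.height = 0 := by
      have : ((m.height : ℕ∞) : WithBot ℕ∞) ≤ 0 := hR ▸ le_iSup₂_of_le m hm le_rfl
      simpa using this
    by_cases ha : a ∈ m
    · obtain ⟨s, hs, n, hn⟩ := exists_notMem_mul_pow_eq_zero (Ideal.height_eq_zero_iff.1 h0) ha
      refine absurd (hle' n ((mem_K n s).2 ?_)) hs
      rw [pow_succ a n, ← mul_assoc, hn, zero_mul]
      exact dvd_zero _
    · refine absurd (hle' 0 ((mem_K 0 a).2 ?_)) ha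
      rw [zero_add, zero_add, pow_one, sq]

/-- A ring with `w-dim R = 0` is strongly π-regular. -/
theorem exists_pow_eq_mul_pow_sq (hR : wKrullDim R = 0) (a : R) :
    ∃ (n : ℕ) (c : R), a ^ (n + 1) = c * (a ^ (n + 1)) ^ 2 := by
  obtain ⟨J, hJ, n, hn⟩ := exists_isGVIdeal_mul_span_pow_le hR a
  have hk : ∀ k, J ^ k * Ideal.span {a} ^ (n + 1) ≤ Ideal.span {a} ^ (n + 1 + k) := by
    intro k
    induction k with
    | zero => simp
    | succ k ih =>
      calc J ^ (k + 1) * Ideal.span {a} ^ (n + 1)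
          = J * (J ^ k * Ideal.span {a} ^ (n + 1)) := by rw [pow_succ', mul_assoc]
        _ ≤ J * Ideal.span {a} ^ (n + 1 + k) := Ideal.mul_mono_right ih
        _ = J * Ideal.span {a} ^ (n + 1) * Ideal.span {a} ^ k := by rw [pow_add, mul_assoc]
        _ ≤ Ideal.span {a} ^ (n + 2) * Ideal.span {a} ^ k := Ideal.mul_mono_left hn
        _ = Ideal.span {a} ^ (n + 1 + (k + 1)) := by rw [← pow_add]; congr 1; omega
  obtain ⟨c, hc⟩ := (hJ.pow (n + 1)).exists_eq_mul_sq (b := a ^ (n + 1)) fun j hj => by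
    have := hk (n + 1) (Ideal.mul_mem_mul hj
      (Ideal.pow_mem_pow (Ideal.mem_span_singleton_self a) (n + 1)))
    rw [Ideal.span_singleton_pow] at this
    obtain ⟨r, hr⟩ := Ideal.mem_span_singleton'.1 this
    exact ⟨r, by rw [← hr, ← pow_mul, mul_two]⟩
  exact ⟨n, c, hc⟩

theorem krullDimLE_zero_of_wKrullDim_eq_zero (hR : wKrullDim R = 0) : Ring.KrullDimLE 0 R := by
  refine Ring.KrullDimLE.mk₀ fun p hp => Ideal.isMaximal_iff.2
    ⟨(Ideal.ne_top_iff_one p).1 hp.ne_top, fun I a hpI hap haI => ?_⟩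
  obtain ⟨n, c, hc⟩ := exists_pow_eq_mul_pow_sq hR a
  have h : a ^ (n + 1) * (1 - c * a ^ (n + 1)) ∈ p := by
    convert p.zero_mem
    linear_combination hc
  have h1 := hpI ((hp.mem_or_mem h).resolve_left fun h => hap (hp.mem_of_pow_mem _ h))
  have h2 : c * a ^ (n + 1) ∈ I := I.mul_mem_left _ (I.pow_mem_of_mem haI _ n.succ_pos)
  simpa using add_mem h1 h2

/-- A finitely generated ideal contained in a minimal prime `p` is nilpotent after localizing at
`p`, hence is not dense; in particular it is not a GV-ideal. -/
theorem IsGVIdeal.not_le_of_mem_minimalPrimes {J p : Ideal R} (hJ : IsGVIdeal J)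
    (hp : p ∈ minimalPrimes R) : ¬ J ≤ p := by
  intro hle
  have := hp.1.1
  have key : ∀ K : Ideal R, K.FG → K ≤ p →
      ∃ s ∉ p, K ≤ Ideal.radical (LinearMap.ker (LinearMap.mulRight R s)) := by
    intro K hK
    induction K, hK using Submodule.fg_induction with
    | singleton x =>
      intro hx
      obtain ⟨s, hs, n, hn⟩ := exists_notMem_mul_pow_eq_zero hp
        (hx (Submodule.mem_span_singleton_self x))
      exact ⟨s, hs, (Ideal.span_singleton_le_iff_mem _).2 ⟨n, by simpa [mul_comm] using hn⟩⟩
    | sup K₁ K₂ _ _ h₁ h₂ =>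
      intro hK
      obtain ⟨s, hs, hs'⟩ := h₁ (le_sup_left.trans hK)
      obtain ⟨t, ht, ht'⟩ := h₂ (le_sup_right.trans hK)
      refine ⟨s * t, fun h => (this.mem_or_mem h).elim hs ht, sup_le
        (hs'.trans (Ideal.radical_mono fun x hx => ?_))
        (ht'.trans (Ideal.radical_mono fun x hx => ?_))⟩
      · have : x * s = 0 := hx
        simp [this]
      · have : x * t = 0 := hx
        rw [LinearMap.mem_ker, LinearMap.mulRight_apply, mul_left_comm, this, mul_zero]
  obtain ⟨s, hs, hJs⟩ := key J hJ.1 hle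
  obtain ⟨n, hn⟩ := Ideal.exists_pow_le_of_le_radical_of_fg hJs hJ.1
  have hs0 : s = 0 := (hJ.pow n).eq_zero fun j hj => hn hj
  exact hs (hs0 ▸ p.zero_mem)

theorem nontrivial_of_wKrullDim_eq_zero (hR : wKrullDim R = 0) : Nontrivial R := by
  by_contra h
  rw [not_nontrivial_iff_subsingleton] at h
  have : wKrullDim R = ⊥ := iSup₂_eq_bot.2 fun m hm => absurd (Subsingleton.elim _ _) hm.1.2
  simp [this] at hR

end

theorem mainTheorem2 (R : Type u) [CommRing R] (hR : wKrullDim R = 0) :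
    ringKrullDim R = 0 ∧ IsDWRing R := by
  have := nontrivial_of_wKrullDim_eq_zero hR
  have hdim := krullDimLE_zero_of_wKrullDim_eq_zero hR
  refine ⟨ringKrullDimZero_iff_ringKrullDim_eq_zero.1 hdim, fun I => isWIdeal_iff.2 ?_⟩
  intro J hJ x hx
  have hJtop : J = ⊤ := by
    by_contra hne
    obtain ⟨p, hp, hJp⟩ := Ideal.exists_le_maximal J hne
    have := hp.isPrime
    exact hJ.not_le_of_mem_minimalPrimes (Ideal.mem_minimalPrimes_of_krullDimLE_zero p) hJp
  simpa using hx 1 (hJtop ▸ trivial)
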